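/- Let $D\ge 1$, let $n_1,\dots,n_D\ge 1$ be integers, $N=\sum_{d=1}^D n_d$, $n_*=\max_d n_d$, and assume $N\ge 2$. For a tensor $X\in\mathbb R^{n_1\times\cdots\times n_D}$ let $\sigma^{(d)}(X)\in\mathbb R^{n_d}$ be the vector of the singular values (in decreasing order, padded by zeros to length $n_d$) of the mode-$d$ matricization of $X$, and let $\sigma(X)=\frac1{\sqrt D}\,(\sigma^{(1)}(X),\dots,\sigma^{(D)}(X))\in\mathbb R^N$. For $\alpha>0$ let $\omega_\alpha^{**}:\mathbb R^N\to[0,+\infty]$ be the convex envelope of the function equal to $\|s\|_0$ (the number of nonzero coordinates of $s$) if $\|s\|_2\le\alpha$ and to $+\infty$ otherwise. Let $m\ge 1$, let $\mathcal G_1,\dots,\mathcal G_m$ be independent random $n_1\times\cdots\times n_D$ tensors with independent $\mathcal N(0,1)$ entries, let $X^\sharp$ be a fixed tensor, and put $y_i=\langle\mathcal G_i,X^\sharp\rangle$. Let $\hat X$ be a (measurable) random tensor that almost surely is a solution of $$\min_{X\in\mathbb R^{n_1\times\cdots\times n_D}}\ \omega_\alpha^{**}(\sigma(X))\quad\text{s.t.}\quad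 \langle\mathcal G_i,X\rangle=y_i,\ i=1,\dots,m.$$ Then, for every integer $r\ge D$, $$\mathbb E\,\|\hat X-X^\sharp\|_F\le\frac{64\,\alpha\sqrt\pi}{\sqrt m}\left[\sqrt{\log p}\;\frac{(1+N)^{D+1}-2^{D+1}}{D+1}+\frac14\sqrt{\pi q}\left(N+\frac{N(1+N)^D-2^D}{D}+\frac{2^{D+1}-(1+N)^{D+1}}{D(D+1)}\right)-\frac{N(1+N)}2\right]\omega_\alpha^{**}(\sigma(X^\sharp)),$$ where $p=\binom{r-1}{D-1}3^{\,r n_*}$ and $q=r n_*+(r/D)^D$. (If $\|X^\sharp\|_F>\alpha$, the right-hand side is $+\infty$.) -/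

import Mathlib

open MeasureTheory ProbabilityTheory
open scoped ENNReal

noncomputable section

/-- Real tensors of size `n₁ × ⋯ × n_D`. The norm and inner product of this space are the Frobenius
norm and the entrywise scalar product. -/
abbrev Tensor {D : ℕ} (n : Fin D → ℕ) : Type :=
  EuclideanSpace ℝ ((d : Fin D) → Fin (n d))

/-- The mode-`d` matricization `X_(d)`: its columns are the mode-`d` fibers of `X`. The columns are
indexed by the multi-indices of the remaining modes; their order is irrelevant for the
singular values. -/
def Tensor.matricization {D : ℕ} {n : Fin D → ℕ} (X : Tensor n) (d : Fin D) :
    Matrix (Fin (n d)) ((e : {e : Fin D // e ≠ d}) → Fin (n e)) ℝ :=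
  Matrix.of fun i j => X ((Equiv.piSplitAt d (fun e => Fin (n e))).symm (i, j))

/-- The mode-`d` spectrum: the `n_d` singular values of `X_(d)`, in decreasing order
(padded by zeros if `X_(d)` has fewer than `n_d` columns). -/
def Tensor.modeSpectrum {D : ℕ} {n : Fin D → ℕ} (X : Tensor n) (d : Fin D) (k : Fin (n d)) : ℝ :=
  (Matrix.toEuclideanLin (X.matricization d)).singularValues (k : ℕ)

/-- The concatenated spectrum `σ(X) = D^{-1/2} (σ^(1)(X), …, σ^(D)(X))`, a vector in `ℝ^N`
with `N = n₁ + ⋯ + n_D`. -/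
def Tensor.spectrum {D : ℕ} {n : Fin D → ℕ} (X : Tensor n) :
    EuclideanSpace ℝ ((d : Fin D) × Fin (n d)) :=
  WithLp.toLp 2 fun dk => X.modeSpectrum dk.1 dk.2 / Real.sqrt D

/-- The convex envelope of an extended-real valued function: the pointwise supremum of all its
convex minorants (convexity being convexity of the epigraph). -/
def convexEnvelope {E : Type*} [AddCommGroup E] [Module ℝ E] (f : E → EReal) (x : E) : EReal :=
  ⨆ φ ∈ {φ : E → EReal | Convex ℝ {p : E × ℝ | φ p.1 ≤ (p.2 : EReal)} ∧ ∀ y, φ y ≤ f y}, φ x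

open Classical in
/-- The cardinality function `‖s‖₀` (number of nonzero coordinates) on the closed Euclidean ball of
radius `α`, with value `+∞` outside that ball. -/
def cardOnBall {ι : Type*} [Fintype ι] (α : ℝ) (s : EuclideanSpace ℝ ι) : EReal :=
  if ‖s‖ ≤ α then (((Finset.univ.filter fun i => s i ≠ 0).card : ℝ) : EReal) else ⊤

/-- The Romera-Paredes--Pontil function `ω_α^{**}`. -/
def rpp {ι : Type*} [Fintype ι] (α : ℝ) : EuclideanSpace ℝ ι → EReal :=
  convexEnvelope (cardOnBall α)

/-- `Xhat` is a solution of the program: minimise `ω_α^{**}(σ(X))` over all tensors `X` with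
`⟨G i, X⟩ = y i` for all `i`. -/
def IsRPPSolution {D : ℕ} {n : Fin D → ℕ} {m : ℕ} (α : ℝ) (G : Fin m → Tensor n) (y : Fin m → ℝ)
    (Xhat : Tensor n) : Prop :=
  (∀ i, inner ℝ (G i) Xhat = y i) ∧
    ∀ X : Tensor n, (∀ i, inner ℝ (G i) X = y i) → rpp α Xhat.spectrum ≤ rpp α X.spectrum

/-- `p = C(r-1, D-1) 3^{r n_*}` with `n_* = max n_d`; the binomial coefficient counts the
decompositions of `r` into `D` positive integers. -/
def rppP {D : ℕ} (n : Fin D → ℕ) (r : ℕ) : ℝ :=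
  ((r - 1).choose (D - 1) : ℝ) * 3 ^ (r * Finset.univ.sup n)

/-- `q = r n_* + (r/D)^D`. -/
def rppQ {D : ℕ} (n : Fin D → ℕ) (r : ℕ) : ℝ :=
  (r : ℝ) * ((Finset.univ.sup n : ℕ) : ℝ) + ((r : ℝ) / D) ^ D

/-- The bracket in the error bound, as a function of `N`, `D`, `p`, `q`. -/
def rppBracket (N : ℝ) (D : ℕ) (p q : ℝ) : ℝ :=
  (Real.sqrt (Real.log p) * (((1 + N) ^ (D + 1) - 2 ^ (D + 1)) / (D + 1)) +
      1 / 4 * Real.sqrt (Real.pi * q) *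
        (N + (N * (1 + N) ^ D - 2 ^ D) / D +
          (2 ^ (D + 1) - (1 + N) ^ (D + 1)) / (D * (D + 1)))) -
    N * (1 + N) / 2

end

/-! The constant is so large that no Gaussian width estimate is needed; the number of measurements
decides between two cases. If `m ≥ ∏ n_d`, the Gaussian measurements almost surely determine the
tensor, so the error vanishes (`ae_eq_zero_of_inner_gaussian_eq_zero`). If `m < ∏ n_d ≤ N^D`, a
deterministic bound suffices. The convex function `‖s‖/α` minorizes `cardOnBall α`, hence `rpp α`,
and `‖σ(X)‖ = ‖X‖`; so minimality and the triangle inequality give error at most `2α · rpp α σ(X♯)`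
(`IsRPPSolution.norm_sub_le`). The bracket is at least `N^D/25`, which absorbs the factor `√m`
(`two_mul_sqrt_le_rppBracket`). -/

/-! ### The norm as a convex minorant. -/

theorem le_convexEnvelope {E : Type*} [AddCommGroup E] [Module ℝ E] {f : E → EReal} {g : E → ℝ}
    (hg : ConvexOn ℝ Set.univ g) (hgf : ∀ y, (g y : EReal) ≤ f y) (x : E) :
    (g x : EReal) ≤ convexEnvelope f x := by
  refine le_iSup₂_of_le (fun y => (g y : EReal)) ⟨?_, hgf⟩ le_rfl
  simpa using hg.convex_epigraph

theorem norm_div_le_cardOnBall {ι : Type*} [Fintype ι] {α : ℝ} (hα : 0 < α)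
    (s : EuclideanSpace ℝ ι) : ((‖s‖ / α : ℝ) : EReal) ≤ cardOnBall α s := by
  classical
  unfold cardOnBall
  split_ifs with h
  · norm_cast
    by_cases hs : s = 0
    · simp [hs]
    · obtain ⟨i, hi⟩ : ∃ i, s i ≠ 0 := by
        by_contra! hc
        exact hs (by ext i; simpa using hc i)
      have h1 : 1 ≤ (Finset.univ.filter fun i => s i ≠ 0).card :=
        Finset.card_pos.2 ⟨i, by simpa using hi⟩
      calc ‖s‖ / α ≤ 1 := (div_le_one hα).2 h
        _ ≤ _ := by exact_mod_cast h1
  · exact le_top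

theorem norm_div_le_rpp {ι : Type*} [Fintype ι] {α : ℝ} (hα : 0 < α)
    (s : EuclideanSpace ℝ ι) : ((‖s‖ / α : ℝ) : EReal) ≤ rpp α s := by
  refine le_convexEnvelope (g := fun s => ‖s‖ / α) ?_ (norm_div_le_cardOnBall hα) s
  have h := (convexOn_univ_norm (E := EuclideanSpace ℝ ι)).smul (inv_nonneg.2 hα.le)
  refine h.congr fun x _ => ?_
  simp [div_eq_inv_mul]

/-! ### The spectrum preserves the Frobenius norm. -/

/-- The squared singular values of a matrix sum to its squared Frobenius norm, even if only those
with index below the number of rows are taken into account. -/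
theorem sum_sq_singularValues_toEuclideanLin {a : ℕ} {ι : Type*} [Fintype ι] [DecidableEq ι]
    (A : Matrix (Fin a) ι ℝ) :
    ∑ k : Fin a, (Matrix.toEuclideanLin A).singularValues k ^ 2 = ∑ i, ∑ j, A i j ^ 2 := by
  set T := Matrix.toEuclideanLin A
  have hrank : Module.finrank ℝ T.range ≤ a := by
    simpa using Submodule.finrank_le T.range
  have h1 : ∀ b : ℕ, Module.finrank ℝ T.range ≤ b →
      ∑ k : Fin b, T.singularValues k ^ 2 =
        ∑ k ∈ Finset.range (Module.finrank ℝ T.range), T.singularValues k ^ 2 := by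
    intro b hb
    rw [Fin.sum_univ_eq_sum_range (fun k => T.singularValues k ^ 2)]
    symm
    refine Finset.sum_subset (Finset.range_mono hb) fun k _ hk => ?_
    rw [T.singularValues_eq_zero_iff_le_finrank_range.2 (by simpa using hk)]
    simp
  -- Singular values vanish from the rank on, so the sum over rows can be traded for the sum over
  -- columns, which is the trace of `T* T`.
  rw [h1 a hrank, ← h1 _ (LinearMap.finrank_range_le T)]
  simp_rw [T.sq_singularValues_fin rfl]
  have h2 := T.isSymmetric_adjoint_comp_self.trace_eq_sum_eigenvalues
    (n := Module.finrank ℝ (EuclideanSpace ℝ ι)) rfl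
  simp only [RCLike.ofReal_real_eq_id, id] at h2
  rw [← h2, LinearMap.trace_eq_sum_inner _ (EuclideanSpace.basisFun ι ℝ), Finset.sum_comm]
  refine Finset.sum_congr rfl fun j _ => ?_
  rw [LinearMap.comp_apply, LinearMap.adjoint_inner_right, real_inner_self_eq_norm_sq,
    EuclideanSpace.norm_sq_eq]
  simp [T, Matrix.toLpLin_apply]

theorem Tensor.sum_sq_modeSpectrum {D : ℕ} {n : Fin D → ℕ} (X : Tensor n) (d : Fin D) :
    ∑ k, X.modeSpectrum d k ^ 2 = ‖X‖ ^ 2 := by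
  unfold Tensor.modeSpectrum
  rw [sum_sq_singularValues_toEuclideanLin, EuclideanSpace.norm_sq_eq,
    ← Fintype.sum_prod_type' (f := fun i j => X.matricization d i j ^ 2),
    ← (Equiv.piSplitAt d (fun e => Fin (n e))).symm.sum_comp]
  simp [Tensor.matricization]

theorem Tensor.norm_spectrum {D : ℕ} (hD : 0 < D) {n : Fin D → ℕ} (X : Tensor n) :
    ‖X.spectrum‖ = ‖X‖ := by
  have hD' : (0 : ℝ) < D := by exact_mod_cast hD
  rw [← sq_eq_sq₀ (norm_nonneg _) (norm_nonneg _), EuclideanSpace.norm_sq_eq,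
    Fintype.sum_sigma]
  simp only [Tensor.spectrum, Real.norm_eq_abs, sq_abs, div_pow, Real.sq_sqrt hD'.le,
    ← Finset.sum_div, X.sum_sq_modeSpectrum]
  simp
  field_simp

theorem Tensor.norm_div_le_rpp_spectrum {D : ℕ} (hD : 0 < D) {n : Fin D → ℕ} {α : ℝ} (hα : 0 < α)
    (X : Tensor n) : ((‖X‖ / α : ℝ) : EReal) ≤ rpp α X.spectrum :=
  X.norm_spectrum hD ▸ norm_div_le_rpp hα X.spectrum

/-! ### Almost sure injectivity of enough Gaussian measurements. -/

theorem MeasureTheory.Measure.AbsolutelyContinuous.pi_fin {k : ℕ} {μ ν : Fin k → Measure ℝ}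
    [∀ i, SigmaFinite (μ i)] [∀ i, SigmaFinite (ν i)] (h : ∀ i, μ i ≪ ν i) :
    Measure.pi μ ≪ Measure.pi ν := by
  induction k with
  | zero =>
    rw [Measure.pi_of_empty μ, Measure.pi_of_empty ν]
  | succ k ih =>
    have hμ := (measurePreserving_piFinSuccAbove μ 0).symm
    have hν := (measurePreserving_piFinSuccAbove ν 0).symm
    rw [← hμ.map_eq, ← hν.map_eq]
    exact ((h 0).prod (ih fun i => h _)).map (MeasurableEquiv.measurable _)

theorem MeasureTheory.Measure.AbsolutelyContinuous.pi_const {ι : Type*} [Fintype ι]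
    {μ ν : Measure ℝ} [SigmaFinite μ] [SigmaFinite ν] (h : μ ≪ ν) :
    Measure.pi (fun _ : ι => μ) ≪ Measure.pi (fun _ : ι => ν) := by
  let e := (Fintype.equivFin ι).symm
  have hμ := measurePreserving_piCongrLeft (fun _ : ι => μ) e
  have hν := measurePreserving_piCongrLeft (fun _ : ι => ν) e
  rw [← hμ.map_eq, ← hν.map_eq]
  exact (pi_fin fun _ => h).map (MeasurableEquiv.measurable _)

/-- Almost every square matrix is invertible. -/
theorem ae_det_ne_zero (ι : Type*) [Fintype ι] [DecidableEq ι] :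
    ∀ᵐ x : ι × ι → ℝ, (Matrix.of fun i j => x (i, j)).det ≠ 0 := by
  let c : ι × ι → ℝ := fun ij => (1 : Matrix ι ι ℝ) ij.1 ij.2
  have hcont : Continuous fun x : ι × ι → ℝ => (Matrix.of fun i j => x (i, j)).det :=
    Continuous.matrix_det (by fun_prop)
  -- On each line `x + t • 1` the determinant is the characteristic polynomial of `-x` at `t`, with
  -- finitely many roots.
  have h1 : ∀ᵐ x : ι × ι → ℝ, ∀ᵐ t : ℝ,
      (Matrix.of fun i j => (x + t • c) (i, j)).det ≠ 0 := by
    refine Filter.Eventually.of_forall fun x => ?_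
    let A : Matrix ι ι ℝ := -Matrix.of fun i j => x (i, j)
    have hA : A.charpoly ≠ 0 := A.charpoly_monic.ne_zero
    have hfin : {t : ℝ | A.charpoly.IsRoot t}.Finite := Polynomial.finite_setOfPred_isRoot hA
    filter_upwards [hfin.countable.ae_notMem volume] with t ht h0
    refine ht ?_
    rw [Polynomial.IsRoot, Matrix.eval_charpoly, ← h0]
    congr 1
    ext i j
    simp [A, c, Matrix.scalar_apply, Matrix.diagonal_apply, Matrix.one_apply, add_comm]
  have hmeas : MeasurableSet {p : (ι × ι → ℝ) × ℝ |
      (Matrix.of fun i j => (p.1 + p.2 • c) (i, j)).det ≠ 0} := by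
    have : Continuous fun p : (ι × ι → ℝ) × ℝ => p.1 + p.2 • c := by fun_prop
    exact ((hcont.comp this).measurable (measurableSet_singleton 0)).compl
  -- By Fubini some shift `t` works for almost every `x`; translation invariance then removes the
  -- shift.
  obtain ⟨t, ht⟩ := ((Measure.ae_ae_comm hmeas).1 h1).exists
  have hqmp := (measurePreserving_add_right (volume : Measure (ι × ι → ℝ)) (-(t • c)))
  filter_upwards [hqmp.quasiMeasurePreserving.ae ht] with x hx
  simpa using hx

/-- A square random matrix with independent standard normal entries is almost surely invertible. -/
theorem ae_det_ne_zero_of_gaussian {Ω : Type*} [MeasurableSpace Ω] {P : Measure Ω}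
    [IsProbabilityMeasure P] {ι : Type*} [Fintype ι] [DecidableEq ι] {Y : ι × ι → Ω → ℝ}
    (hlaw : ∀ ij, HasLaw (Y ij) (gaussianReal 0 1) P) (hindep : iIndepFun Y P) :
    ∀ᵐ w ∂P, (Matrix.of fun i j => Y (i, j) w).det ≠ 0 := by
  have hm : ∀ ij, AEMeasurable (Y ij) P := fun ij => (hlaw ij).aemeasurable
  have hmap := (iIndepFun_iff_map_fun_eq_pi_map hm).1 hindep
  simp_rw [fun ij => (hlaw ij).map_eq] at hmap
  have hac : P.map (fun w ij => Y ij w) ≪ volume := by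
    rw [hmap, volume_pi]
    exact Measure.AbsolutelyContinuous.pi_const (gaussianReal_absolutelyContinuous 0 one_ne_zero)
  exact ae_of_ae_map (aemeasurable_pi_lambda _ hm) (hac.ae_le (ae_det_ne_zero ι))

/-- At least `card κ` independent standard Gaussian vectors in `ℝ^κ` almost surely separate
points. -/
theorem ae_eq_zero_of_inner_gaussian_eq_zero {Ω : Type*} [MeasurableSpace Ω] {P : Measure Ω}
    [IsProbabilityMeasure P] {κ : Type*} [Fintype κ] {m : ℕ} (hm : Fintype.card κ ≤ m)
    {G : Fin m → Ω → EuclideanSpace ℝ κ}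
    (hlaw : ∀ i j, HasLaw (fun w => G i w j) (gaussianReal 0 1) P)
    (hindep : iIndepFun (fun (ij : Fin m × κ) (w : Ω) => G ij.1 w ij.2) P) :
    ∀ᵐ w ∂P, ∀ v : EuclideanSpace ℝ κ, (∀ i, inner ℝ (G i w) v = 0) → v = 0 := by
  classical
  obtain ⟨e⟩ : Nonempty (κ ↪ Fin m) := Function.Embedding.nonempty_of_card_le (by simpa using hm)
  have hinj : Function.Injective fun ij : κ × κ => (e ij.1, ij.2) := fun a b h => by
    simp only [Prod.mk.injEq, e.apply_eq_iff_eq] at h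
    exact Prod.ext h.1 h.2
  filter_upwards [ae_det_ne_zero_of_gaussian (Y := fun (ij : κ × κ) w => G (e ij.1) w ij.2)
    (fun ij => hlaw _ _) (hindep.precomp hinj)] with w hw v hv
  have h0 : (Matrix.of fun i j => G (e i) w j).mulVec v.ofLp = 0 := by
    ext i
    have h := hv (e i)
    rw [PiLp.inner_apply] at h
    simpa [Matrix.mulVec, dotProduct, mul_comm] using h
  ext j
  exact congrFun (Matrix.eq_zero_of_mulVec_eq_zero hw h0) j

/-! ### Lower bounds for the bracket. -/

theorem natCast_mul_pow_le_pow_sub_pow {N : ℝ} (hN : 2 ≤ N) (D : ℕ) :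
    ((D : ℝ) + 1) * N ^ D ≤ (1 + N) ^ (D + 1) - 2 ^ (D + 1) := by
  have h2 : (2 : ℝ) ^ (D + 1) ≤ N ^ (D + 1) := pow_le_pow_left₀ (by norm_num) hN _
  -- The first two terms of the binomial expansion.
  have h3 : N ^ (D + 1) + (D + 1) * N ^ D ≤ (1 + N) ^ (D + 1) := by
    clear h2
    induction D with
    | zero => simp; linarith
    | succ D ih =>
      have hp : 0 ≤ N ^ D := by positivity
      have := mul_le_mul_of_nonneg_left ih (by linarith : 0 ≤ 1 + N)
      push_cast
      rw [pow_succ (1 + N) (D + 1)]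
      have e : (1 + N) * (N ^ (D + 1) + (D + 1) * N ^ D) =
        N ^ (D + 1 + 1) + (D + 1 + 1) * N ^ (D + 1) + (D + 1) * N ^ D := by ring
      have : 0 ≤ ((D : ℝ) + 1) * N ^ D := by positivity
      linarith
  linarith

/-- After division by `D + 1` the right side is the integral of `(1 + t)^D` over `[1, N]`, which
increases with `D`; equality holds at `D = 1`. -/
theorem natCast_mul_sq_sub_le_pow_sub_pow {N : ℝ} (hN : 2 ≤ N) {D : ℕ} (hD : 0 < D) :
    ((D : ℝ) + 1) * (((1 + N) ^ 2 - 4) / 2) ≤ (1 + N) ^ (D + 1) - 2 ^ (D + 1) := by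
  induction D, hD using Nat.le_induction with
  | base => norm_num; linarith
  | succ D hD ih =>
    have hD' : (1 : ℝ) ≤ D := by exact_mod_cast hD
    have h0 : 0 ≤ ((1 + N) ^ 2 - 4) / 2 := by nlinarith
    have hp : 0 ≤ (1 + N) ^ (D + 1) * (N - 1) :=
      mul_nonneg (pow_nonneg (by linarith) _) (by linarith)
    push_cast
    rw [pow_succ _ (D + 1), pow_succ (2 : ℝ) (D + 1)]
    nlinarith

/-- The coefficient of `√(π q) / 4` in the bracket is nonnegative. -/
theorem rppBracket_coeff_nonneg {N : ℝ} (hN : 2 ≤ N) {D : ℕ} (hD : 0 < D) :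
    0 ≤ N + (N * (1 + N) ^ D - 2 ^ D) / D +
          (2 ^ (D + 1) - (1 + N) ^ (D + 1)) / (D * (D + 1)) := by
  have hD' : (1 : ℝ) ≤ D := by exact_mod_cast hD
  have e : N + (N * (1 + N) ^ D - 2 ^ D) / D +
      (2 ^ (D + 1) - (1 + N) ^ (D + 1)) / (D * (D + 1)) =
      N + ((1 + N) ^ D * (N * D - 1) - 2 ^ D * (D - 1)) / (D * (D + 1)) := by
    field_simp
    ring
  rw [e]
  have h1 : (2 : ℝ) ^ D * (D - 1) ≤ (1 + N) ^ D * (N * D - 1) := by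
    refine mul_le_mul (pow_le_pow_left₀ (by norm_num) (by linarith) _) (by nlinarith)
      (by linarith) (by positivity)
  have : 0 ≤ ((1 + N) ^ D * (N * D - 1) - 2 ^ D * (D - 1)) / (D * (D + 1)) :=
    div_nonneg (by linarith) (by positivity)
  linarith

theorem pow_div_le_rppBracket {N : ℝ} (hN : 2 ≤ N) {D : ℕ} (hD : 0 < D) {p q : ℝ}
    (hp : 37 / 25 ≤ √(Real.log p)) : N ^ D / 25 ≤ rppBracket N D p q := by
  have hD' : (1 : ℝ) ≤ D := by exact_mod_cast hD
  have h1 : N ^ D ≤ ((1 + N) ^ (D + 1) - 2 ^ (D + 1)) / (D + 1) := by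
    rw [le_div_iff₀ (by linarith), mul_comm]
    exact natCast_mul_pow_le_pow_sub_pow hN D
  have h2 : ((1 + N) ^ 2 - 4) / 2 ≤ ((1 + N) ^ (D + 1) - 2 ^ (D + 1)) / (D + 1) := by
    rw [le_div_iff₀ (by linarith), mul_comm]
    exact natCast_mul_sq_sub_le_pow_sub_pow hN hD
  have h3 := mul_nonneg (by positivity : 0 ≤ 1 / 4 * √(Real.pi * q))
    (rppBracket_coeff_nonneg hN hD)
  have h0 : 0 ≤ N ^ D := by positivity
  -- Split 37/25 = 36/25 + 1/25: by `h2` the first share absorbs `N(1+N)/2`, by `h1` the second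
  -- leaves `N^D/25`.
  have h4 := mul_le_mul_of_nonneg_right hp (h0.trans h1)
  unfold rppBracket
  nlinarith

/-- Since `r n_* ≥ D n_* ≥ N ≥ 2`, one has `p ≥ 9`, and `log 9 ≈ 2.197` exceeds `(37/25)^2 =
2.1904`. -/
theorem sqrt_log_rppP_ge {D : ℕ} {n : Fin D → ℕ} (hD : 0 < D) (hN : 1 < ∑ d, n d) {r : ℕ}
    (hr : D ≤ r) : 37 / 25 ≤ √(Real.log (rppP n r)) := by
  have hsum : ∑ d, n d ≤ D * Finset.univ.sup n := by
    simpa using Finset.sum_le_card_nsmul Finset.univ n _ fun d hd => Finset.le_sup hd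
  have hexp : 2 ≤ r * Finset.univ.sup n :=
    (hN.trans_le hsum).trans_le (Nat.mul_le_mul_right _ hr)
  have hch : 1 ≤ (r - 1).choose (D - 1) := Nat.choose_pos (by omega)
  have hp : (9 : ℝ) ≤ rppP n r := by
    have h3 : (3 : ℝ) ^ 2 ≤ 3 ^ (r * Finset.univ.sup n) := pow_le_pow_right₀ (by norm_num) hexp
    have hch' : (1 : ℝ) ≤ ((r - 1).choose (D - 1) : ℕ) := by exact_mod_cast hch
    unfold rppP
    nlinarith
  refine Real.le_sqrt_of_sq_le ?_
  refine le_trans ?_ (Real.log_le_log (by norm_num) hp)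
  have h8 : Real.log 8 = 3 * Real.log 2 := by
    rw [show (8 : ℝ) = 2 ^ 3 by norm_num, Real.log_pow]; norm_num
  have h98 : 1 - (9 / 8 : ℝ)⁻¹ ≤ Real.log (9 / 8) := Real.one_sub_inv_le_log_of_pos (by norm_num)
  rw [show (9 : ℝ) = 8 * (9 / 8) by norm_num, Real.log_mul (by norm_num) (by norm_num), h8]
  have := Real.log_two_gt_d9
  norm_num at h98 ⊢
  linarith

theorem card_multiIndex_le {D : ℕ} (n : Fin D → ℕ) :
    Fintype.card ((d : Fin D) → Fin (n d)) ≤ (∑ d, n d) ^ D := by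
  have h := Finset.prod_le_pow_card Finset.univ n (∑ d, n d)
    fun d hd => Finset.single_le_sum (fun _ _ => Nat.zero_le _) hd
  simpa using h

theorem two_mul_sqrt_le_rppBracket {D : ℕ} {n : Fin D → ℕ} (hD : 0 < D) (hN : 1 < ∑ d, n d)
    {r : ℕ} (hr : D ≤ r) {m : ℕ} (hm : m < Fintype.card ((d : Fin D) → Fin (n d))) :
    2 * √(m : ℝ) ≤
      64 * √Real.pi * rppBracket ((∑ d, n d : ℕ) : ℝ) D (rppP n r) (rppQ n r) := by
  have hN' : (2 : ℝ) ≤ ((∑ d, n d : ℕ) : ℝ) := by exact_mod_cast hN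
  have hb := pow_div_le_rppBracket hN' hD (q := rppQ n r) (sqrt_log_rppP_ge hD hN hr)
  have hm1 : (m : ℝ) + 1 ≤ ((∑ d, n d : ℕ) : ℝ) ^ D := by
    exact_mod_cast Nat.succ_le_of_lt (hm.trans_le (card_multiIndex_le n))
  -- This crude bound is enough: `2√m ≤ 2 N^D ≤ 50 b ≤ 64 √π b`, with `b` the bracket.
  have hs : √(m : ℝ) ≤ (m : ℝ) + 1 := by
    rw [Real.sqrt_le_left (by positivity)]
    nlinarith [(Nat.cast_nonneg m : (0 : ℝ) ≤ m)]
  have hpi : 1 ≤ √Real.pi := Real.one_le_sqrt.2 (by linarith [Real.pi_gt_three])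
  have h0 : 0 ≤ rppBracket ((∑ d, n d : ℕ) : ℝ) D (rppP n r) (rppQ n r) :=
    le_trans (by positivity) hb
  nlinarith [mul_le_mul_of_nonneg_right hpi h0]

theorem rppBracket_nonneg {D : ℕ} {n : Fin D → ℕ} (hD : 0 < D) (hN : 1 < ∑ d, n d)
    {r : ℕ} (hr : D ≤ r) :
    0 ≤ rppBracket ((∑ d, n d : ℕ) : ℝ) D (rppP n r) (rppQ n r) :=
  le_trans (by positivity)
    (pow_div_le_rppBracket (by exact_mod_cast hN) hD (sqrt_log_rppP_ge hD hN hr))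

/-! ### The deterministic error bound and the conclusion. -/

theorem IsRPPSolution.norm_sub_le {D : ℕ} (hD : 0 < D) {n : Fin D → ℕ} {m : ℕ} {α : ℝ}
    (hα : 0 < α) {G : Fin m → Tensor n} {X Xhat : Tensor n}
    (h : IsRPPSolution α G (fun i => inner ℝ (G i) X) Xhat) {τ : ℝ}
    (hτ : rpp α X.spectrum = τ) : ‖Xhat - X‖ ≤ 2 * α * τ := by
  have h1 : ‖Xhat‖ / α ≤ τ := by
    have := ((Xhat.norm_div_le_rpp_spectrum hD hα).trans (h.2 X fun _ => rfl)).trans_eq hτ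
    exact_mod_cast this
  have h2 : ‖X‖ / α ≤ τ := by
    exact_mod_cast (X.norm_div_le_rpp_spectrum hD hα).trans_eq hτ
  rw [div_le_iff₀ hα] at h1 h2
  linarith [_root_.norm_sub_le Xhat X]

theorem mainTheorem2 {Ω : Type*} [MeasurableSpace Ω] (P : Measure Ω) [IsProbabilityMeasure P]
    (D : ℕ) (n : Fin D → ℕ) (hn : ∀ d, 0 < n d) (hN : 1 < ∑ d, n d)
    (m : ℕ) (hm : 0 < m) (α : ℝ) (hα : 0 < α)
    (G : Fin m → Ω → Tensor n)
    (hGlaw : ∀ (i : Fin m) (j : (d : Fin D) → Fin (n d)),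
      HasLaw (fun w => G i w j) (gaussianReal 0 1) P)
    (hGindep : iIndepFun
      (fun (ij : Fin m × ((d : Fin D) → Fin (n d))) (w : Ω) => G ij.1 w ij.2) P)
    (Xsharp : Tensor n)
    (Xhat : Ω → Tensor n) (hXmeas : AEMeasurable Xhat P)
    (hXhat : ∀ᵐ w ∂P, IsRPPSolution α (fun i => G i w)
      (fun i => inner ℝ (G i w) Xsharp) (Xhat w))
    (r : ℕ) (hr : D ≤ r) :
    ((∫⁻ w, ‖Xhat w - Xsharp‖ₑ ∂P : ℝ≥0∞) : EReal) ≤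
      ((64 * α * Real.sqrt Real.pi / Real.sqrt m *
          rppBracket ((∑ d, n d : ℕ) : ℝ) D (rppP n r) (rppQ n r) : ℝ) : EReal) *
        rpp α Xsharp.spectrum := by

  have hD : 0 < D := Nat.pos_of_ne_zero fun h => by subst h; simp at hN
  have hb := rppBracket_nonneg hD hN hr
  have hm' : (0 : ℝ) < √(m : ℝ) := Real.sqrt_pos.2 (by exact_mod_cast hm)
  set b := rppBracket ((∑ d, n d : ℕ) : ℝ) D (rppP n r) (rppQ n r) with hbdef
  have hC : 0 ≤ 64 * α * √Real.pi / √(m : ℝ) * b := by positivity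
  have hrpp : 0 ≤ rpp α Xsharp.spectrum :=
    le_trans (by exact_mod_cast (by positivity : 0 ≤ ‖Xsharp‖ / α))
      (Xsharp.norm_div_le_rpp_spectrum hD hα)
  by_cases hcard : Fintype.card ((d : Fin D) → Fin (n d)) ≤ m
  · have h0 : ∫⁻ w, ‖Xhat w - Xsharp‖ₑ ∂P = 0 := by
      rw [← lintegral_zero (μ := P)]
      refine lintegral_congr_ae ?_
      filter_upwards [hXhat, ae_eq_zero_of_inner_gaussian_eq_zero hcard hGlaw hGindep]
        with w hw hinj
      have h : Xhat w - Xsharp = 0 := hinj _ fun i => by rw [inner_sub_right, hw.1 i, sub_self]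
      rw [h, enorm_zero]
    rw [h0]
    exact mul_nonneg (by exact_mod_cast hC) hrpp
  · have hkey := two_mul_sqrt_le_rppBracket hD hN hr (not_le.1 hcard)
    rw [← hbdef] at hkey
    have hC2 : 2 * α ≤ 64 * α * √Real.pi / √(m : ℝ) * b := by
      rw [div_mul_eq_mul_div, le_div_iff₀ hm']
      nlinarith
    -- In `EReal`, `0 * ⊤ = 0`, so the infinite case needs a strictly positive constant, which `hC2`
    -- supplies.
    rcases eq_or_ne (rpp α Xsharp.spectrum) ⊤ with htop | htop
    · rw [htop, EReal.coe_mul_top_of_pos (by linarith)]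
      exact le_top
    lift rpp α Xsharp.spectrum to ℝ using
      ⟨htop, (lt_of_lt_of_le EReal.bot_lt_zero hrpp).ne'⟩ with τ hτ
    have hτ0 : 0 ≤ τ := by exact_mod_cast hrpp
    have hle : ∫⁻ w, ‖Xhat w - Xsharp‖ₑ ∂P ≤ ENNReal.ofReal (2 * α * τ) := by
      calc ∫⁻ w, ‖Xhat w - Xsharp‖ₑ ∂P ≤ ∫⁻ _, ENNReal.ofReal (2 * α * τ) ∂P := by
            refine lintegral_mono_ae ?_
            filter_upwards [hXhat] with w hw
            rw [← ofReal_norm]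
            exact ENNReal.ofReal_le_ofReal (hw.norm_sub_le hD hα hτ.symm)
        _ = _ := by simp
    calc ((∫⁻ w, ‖Xhat w - Xsharp‖ₑ ∂P : ℝ≥0∞) : EReal)
        ≤ ((ENNReal.ofReal (2 * α * τ) : ℝ≥0∞) : EReal) := by exact_mod_cast hle
      _ = ((2 * α * τ : ℝ) : EReal) := by
          rw [EReal.coe_ennreal_ofReal, max_eq_left (by positivity)]
      _ ≤ _ := by
          rw [← EReal.coe_mul]
          exact_mod_cast mul_le_mul_of_nonneg_right hC2 hτ0
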